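/- Conventions. Limsups are non-exclusive: for $g:K\to[-\infty,\infty]$, $\limsup_{y\to x}g(y)=\inf_V\sup_{y\in V}g(y)$, the infimum over all open neighbourhoods $V$ of $x$. The upper semicontinuous envelope of $g$ is $Ug(x)=\limsup_{y\to x}g(y)$. For a real-valued function $\varphi$ on $K$ and a countable ordinal $\alpha$, the $\alpha$-th positive oscillation $v_\alpha(\varphi):K\to[0,\infty]$ is defined by transfinite recursion: $v_0(\varphi)\equiv 0$; $v_{\alpha+1}(\varphi)=U\tilde v_{\alpha+1}(\varphi)$ with $\tilde v_{\alpha+1}(\varphi)(x)=\limsup_{y\to x}\bigl(\varphi(y)-\varphi(x)+v_\alpha(\varphi)(y)\bigr)$; and $v_\beta(\varphi)=U\bigl(\sup_{\alpha<\beta}v_\alpha(\varphi)\bigr)$ for a limit ordinal $\beta$. **Theorem 4.1.** Let $\alpha\ge 1$ be a countable ordinal, $K$ a separable metric space, $f:K\to\mathbb C$, and let $(f_j)_{j\ge1}$ be a uniformly bounded sequence of complex-valued continuous functions on $K$ with $f_j\to f$ pointwise. Let $x\in K$, assume $0<\lambda<\infty$ where $\lambda=v_\alpha(\operatorname{Re}f)(x)$,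 and let $0<\eta<1$. Then there exists a subsequence $(b_j)_{j\ge1}$ of $(f_j)$ such that, setting $e_1=b_1$ and $e_j=b_j-b_{j-1}$ for $j>1$, the following holds: for every infinite sequence of indices $1=m_1<m_2<\cdots$ there exist a point $t\in K$ and an integer $k$ with 1. $\sum_{j=1}^k\operatorname{Re}e_{m_{2j}}(t)>(1-\eta)\lambda$; 2. $\operatorname{Re}e_{m_{2j}}(t)>0$ for all $1\le j\le k$; 3. $\sum_{i\notin\{m_1,m_2,\dots\}}|e_i(t)|<\eta\lambda$. -/

import Mathlib

open Filter Topology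

/-- The upper semicontinuous envelope `U g` of an extended real function `g`:
`U g (x) = limsup_{y → x} g y`, where the limsup is non-exclusive (the point `y = x` counts),
i.e. it is the infimum over neighbourhoods `V` of `x` of `sup_{y ∈ V} g y`. -/
noncomputable def uscEnvelope {K : Type*} [TopologicalSpace K] (g : K → EReal) : K → EReal :=
  fun x => limsup g (𝓝 x)

/-- The `α`-th positive oscillation `v_α φ` of a real function `φ`, by transfinite recursion:
`v_0 φ = 0`; `v_{α+1} φ` is the upper semicontinuous envelope of
`x ↦ limsup_{y → x} (φ y - φ x + v_α φ y)` (non-exclusive limsup); and for a limit ordinal `β`,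
`v_β φ` is the upper semicontinuous envelope of `x ↦ sup_{α < β} v_α φ x`. -/
noncomputable def posOsc {K : Type*} [TopologicalSpace K] (φ : K → ℝ) (α : Ordinal.{0}) :
    K → EReal :=
  Ordinal.limitRecOn (motive := fun _ => K → EReal) α
    (fun _ => 0)
    (fun _ v => uscEnvelope fun x => limsup (fun y => ((φ y - φ x : ℝ) : EReal) + v y) (𝓝 x))
    (fun β _ v => uscEnvelope fun x => ⨆ γ : Set.Iio β, v γ.1 γ.2 x)

theorem posOsc_zero {K : Type*} [TopologicalSpace K] (φ : K → ℝ) :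
    posOsc φ 0 = fun _ => 0 := by
  simp [posOsc]

theorem posOsc_add_one {K : Type*} [TopologicalSpace K] (φ : K → ℝ) (α : Ordinal.{0}) :
    posOsc φ (α + 1) = uscEnvelope fun x =>
      limsup (fun y => ((φ y - φ x : ℝ) : EReal) + posOsc φ α y) (𝓝 x) := by
  simp [posOsc]

theorem posOsc_limit {K : Type*} [TopologicalSpace K] (φ : K → ℝ) {β : Ordinal.{0}}
    (hβ : Order.IsSuccLimit β) :
    posOsc φ β = uscEnvelope fun x => ⨆ γ : Set.Iio β, posOsc φ γ.1 x := by
  simp [posOsc, Ordinal.limitRecOn_limit _ _ _ _ hβ]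

/-- The difference sequence of `b`. Sequences are indexed by `ℕ` starting at `0`,
so this is `e 0 = b 0` and `e (i + 1) = b (i + 1) - b i`. -/
def diffSeq {K : Type*} (b : ℕ → K → ℂ) : ℕ → K → ℂ
  | 0 => b 0
  | i + 1 => fun t => b (i + 1) t - b i t

/-! Write `φ = Re f` and `R = (1 - η) λ`. If `v_β φ` exceeds `c ≥ 0` at a point, then near it there
is a point `z`, and arbitrarily near `z` points `y`, such that `φ y - φ z` is bounded below by a
positive constant and `φ y - φ z + v_γ φ y > c` for some `γ < β` (`frequently_jump_of_lt_posOsc`).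

The selected indices are spent in pairs. At the first, the current point moves to such a `z`, and
the new term is chosen close to `f` there. At the second, it moves to a `y` so near `z` that the
preceding continuous term is still nearly `f z`, while the new term is nearly `f y`. The new
difference is then positive and nearly `φ y - φ z`, and the missing part of `R` stays below `v_γ φ
y`. Earlier differences change little under these moves, by continuity. At an unselected index the
point stays put and pointwise convergence makes the difference as small as desired. Each pair lowers
the ordinal and `v_0 = 0`, so the sum exceeds `R` after finitely many pairs; the point is then
frozen.

The subsequence must not depend on `m`. After `n` steps there are only finitely many selection
patterns, so one large index serves them all (`exists_strictMono_forall_run`). -/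

/-! ### Jumps produced by positive oscillation -/

theorem frequently_jump_of_lt_posOsc {K : Type*} [TopologicalSpace K] (φ : K → ℝ)
    (β : Ordinal.{0}) : ∀ (x : K) (c : ℝ), 0 ≤ c → (c : EReal) < posOsc φ β x →
      ∃ᶠ z in 𝓝 x, ∃ δ > 0, ∃ᶠ y in 𝓝 z, δ < φ y - φ z ∧
        ∃ γ < β, (c : EReal) < ((φ y - φ z : ℝ) : EReal) + posOsc φ γ y := by
  induction β using Ordinal.limitRecOn with
  | zero =>
    intro x c hc h
    rw [posOsc_zero] at h
    exact absurd (EReal.coe_lt_coe_iff.1 h) (not_lt.2 hc)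
  | add_one β ih =>
    intro x c hc h
    obtain ⟨c', hc', h'⟩ := EReal.lt_iff_exists_real_btwn.1 h
    have hcc : c < c' := EReal.coe_lt_coe_iff.1 hc'
    rw [posOsc_add_one] at h'
    have h1 := Filter.frequently_lt_of_lt_limsup (by isBoundedDefault) h'
    have hlt : β < β + 1 := lt_add_one β
    rw [← frequently_frequently_nhds]
    refine h1.mono fun z hz => ?_
    have h2 := Filter.frequently_lt_of_lt_limsup (by isBoundedDefault) hz
    -- Either jumps larger than the slack `c' - c` recur near `z`, or small jumps already force `v_β
    -- > c` near `z` and the induction hypothesis supplies the jump.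
    by_cases h3 : ∃ᶠ y in 𝓝 z, (c' : EReal) < ((φ y - φ z : ℝ) : EReal) + posOsc φ β y ∧
        c' - c < φ y - φ z
    · have : ∃ δ > 0, ∃ᶠ y in 𝓝 z, δ < φ y - φ z ∧
          ∃ γ < β + 1, (c : EReal) < ((φ y - φ z : ℝ) : EReal) + posOsc φ γ y :=
        ⟨c' - c, sub_pos.2 hcc, h3.mono fun y hy => ⟨hy.2, β, hlt, hc'.trans hy.1⟩⟩
      intro hcon
      exact hcon.self_of_nhds this
    · rw [← frequently_frequently_nhds]
      refine (h2.and_eventually (Filter.not_frequently.1 h3)).mono fun y ⟨hy, hy'⟩ => ?_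
      have hj : φ y - φ z ≤ c' - c := by
        by_contra hj
        exact hy' ⟨hy, not_le.1 hj⟩
      have hv : (c : EReal) < posOsc φ β y := by
        by_contra hv
        refine absurd hy (not_lt.2 ?_)
        calc ((φ y - φ z : ℝ) : EReal) + posOsc φ β y
            ≤ ((c' - c : ℝ) : EReal) + (c : EReal) :=
              add_le_add (EReal.coe_le_coe_iff.2 hj) (not_lt.1 hv)
          _ = c' := by rw [← EReal.coe_add]; simp
      exact (ih y c hc hv).mono fun w ⟨δ, hδ, hw⟩ => ⟨δ, hδ, hw.mono fun u ⟨hu, γ, hγ, hu'⟩ =>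
        ⟨hu, γ, hγ.trans hlt, hu'⟩⟩
  | limit β hβ ih =>
    intro x c hc h
    rw [posOsc_limit φ hβ] at h
    rw [← frequently_frequently_nhds]
    refine (Filter.frequently_lt_of_lt_limsup (by isBoundedDefault) h).mono fun y hy => ?_
    obtain ⟨⟨γ, hγ⟩, hy⟩ := lt_iSup_iff.1 hy
    exact (ih γ hγ y c hc hy).mono fun w ⟨δ, hδ, hw⟩ => ⟨δ, hδ, hw.mono fun u ⟨hu, γ', hγ', hu'⟩ =>
      ⟨hu, γ', hγ'.trans hγ, hu'⟩⟩

/-! ### One subsequence for all selection patterns -/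

/-- If every legal state can be continued, for either input bit, as soon as the next index is
large enough, then one strictly increasing sequence of indices supports a run on every input. -/
theorem exists_strictMono_forall_run {S : Type*} (Inv : ℕ → (ℕ → ℕ) → S → Prop)
    (rel : ℕ → Bool → S → S → Prop) (s₀ : S)
    (hcongr : ∀ n p q s, (∀ i < n, p i = q i) → Inv n p s → Inv n q s)
    (hstep : ∀ n p s c, Inv n p s →
      ∃ s', rel n c s s' ∧ ∀ᶠ N in atTop, Inv (n + 1) (Function.update p n N) s')
    (h₀ : Inv 0 id s₀) :
    ∃ σ : ℕ → ℕ, StrictMono σ ∧ ∀ c : ℕ → Bool, ∃ s : ℕ → S, s 0 = s₀ ∧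
      ∀ n, rel n (c n) (s n) (s (n + 1)) ∧ Inv n σ (s n) := by
  let X : ℕ → Type _ := fun n =>
    {a : (ℕ → ℕ) × Set S // a.2.Finite ∧ ∀ s ∈ a.2, Inv n a.1 s}
  have hX : ∀ n (a : X n), ∃ b : X (n + 1), (∀ i < n, b.1.1 i = a.1.1 i) ∧
      (∀ i < n, a.1.1 i < b.1.1 n) ∧ ∀ s ∈ a.1.2, ∀ c, ∃ s' ∈ b.1.2, rel n c s s' := by
    rintro n ⟨⟨p, A⟩, hA, hInv⟩
    have : ∀ (s : S) (c : Bool), ∃ s', s ∈ A → rel n c s s' ∧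
        ∀ᶠ N in atTop, Inv (n + 1) (Function.update p n N) s' := by
      intro s c
      by_cases hs : s ∈ A
      · obtain ⟨s', h⟩ := hstep n p s c (hInv s hs)
        exact ⟨s', fun _ => h⟩
      · exact ⟨s, fun h => absurd h hs⟩
    choose g hg using this
    -- Only finitely many pairs of a reachable state and a bit occur, so their "eventually"
    -- conditions hold simultaneously.
    have h1 : ∀ᶠ N in atTop, ∀ s ∈ A, ∀ c, Inv (n + 1) (Function.update p n N) (g s c) :=
      (Filter.eventually_all_finite hA).2 fun s hs =>
        Filter.eventually_all.2 fun c => (hg s c hs).2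
    have h2 : ∀ᶠ N in atTop, ∀ i ∈ Set.Iio n, p i < N :=
      (Filter.eventually_all_finite (Set.finite_Iio n)).2 fun i _ => eventually_gt_atTop (p i)
    obtain ⟨N, hN1, hN2⟩ := (h1.and h2).exists
    refine ⟨⟨⟨Function.update p n N, ⋃ c, (fun s => g s c) '' A⟩,
      Set.finite_iUnion fun c => hA.image _, ?_⟩, ?_, ?_, ?_⟩
    · intro s hs
      obtain ⟨c, u, hu, rfl⟩ := Set.mem_iUnion.1 hs
      exact hN1 u hu c
    · intro i hi
      exact Function.update_of_ne hi.ne _ _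
    · intro i hi
      simpa using hN2 i hi
    · intro s hs c
      exact ⟨g s c, Set.mem_iUnion.2 ⟨c, s, hs, rfl⟩, (hg s c hs).1⟩
  choose next hn1 hn2 hn3 using hX
  let Y : ∀ n, X n := fun n => Nat.rec
    ⟨⟨id, {s₀}⟩, Set.finite_singleton _, by simpa using h₀⟩ next n
  have hY : ∀ n, Y (n + 1) = next n (Y n) := fun _ => rfl
  let σ : ℕ → ℕ := fun n => (Y (n + 1)).1.1 n
  have hσ : ∀ n, ∀ i < n, (Y n).1.1 i = σ i := by
    intro n
    induction n with
    | zero => intro i hi; omega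
    | succ n ih =>
      intro i hi
      rcases Nat.lt_succ_iff_lt_or_eq.1 hi with h | rfl
      · rw [hY, hn1 _ _ i h, ih i h]
      · rfl
  refine ⟨σ, strictMono_nat_of_lt_succ fun n => hn2 (n + 1) (Y (n + 1)) n n.lt_succ_self, ?_⟩
  intro c
  choose! g hgA hgR using fun n => hn3 n (Y n)
  let s : ℕ → S := fun n => Nat.rec s₀ (fun n t => g n t (c n)) n
  have hs : ∀ n, s n ∈ (Y n).1.2 := by
    intro n
    induction n with
    | zero => exact Set.mem_singleton _
    | succ n ih => exact hgA n (s n) ih (c n)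
  exact ⟨s, rfl, fun n => ⟨hgR n (s n) (hs n) (c n),
    hcongr n _ _ _ (hσ n) ((Y n).2.2 _ (hs n))⟩⟩

/-! ### States, invariant and transitions of a run -/

theorem continuous_diffSeq {K : Type*} [TopologicalSpace K] {b : ℕ → K → ℂ}
    (hb : ∀ n, Continuous (b n)) : ∀ n, Continuous (diffSeq b n)
  | 0 => hb 0
  | n + 1 => (hb (n + 1)).sub (hb n)

theorem diffSeq_congr {K : Type*} {b b' : ℕ → K → ℂ} {n : ℕ} (h : ∀ i < n, b i = b' i) :
    ∀ i < n, diffSeq b i = diffSeq b' i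
  | 0, hi => h 0 hi
  | i + 1, hi => by
    funext t
    simp [diffSeq, h (i + 1) hi, h i (by omega)]

/-- The phases of a run: `idle` before a step to a nearby point with a large jump,
`armed δ` at a point where jumps larger than `δ` are available, and `done`. -/
inductive OscPhase
  | idle
  | armed (δ : ℝ)
  | done

/-- A state of a run: the current point, the order of oscillation that is left, the indices
selected so far, those of them that carry jumps, and the phase. -/
structure OscState (K : Type*) where
  pt : K
  ord : Ordinal.{0}
  seen : Finset ℕ
  jumps : Finset ℕ
  phase : OscPhase

/-- The real part of the sum of the selected differences. -/
noncomputable def jumpSum {K : Type*} (b : ℕ → K → ℂ) (J : Finset ℕ) (t : K) : ℝ :=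
  ∑ i ∈ J, (diffSeq b i t).re

/-- The total size of the differences before `n`, other than the first, that were not selected. -/
noncomputable def restSum {K : Type*} (b : ℕ → K → ℂ) (E : Finset ℕ) (n : ℕ) (t : K) : ℝ :=
  ∑ i ∈ Finset.Ico 1 n \ E, ‖diffSeq b i t‖

/-- The distance from the limit of the last term of the sequence before `n`. -/
noncomputable def lastDist {K : Type*} (f : K → ℂ) (b : ℕ → K → ℂ) : ℕ → K → ℝ
  | 0, _ => 0
  | n + 1, t => ‖b n t - f t‖

/-- What the phase of a run promises about the oscillation at the current point. -/
def PhaseInv {K : Type*} [TopologicalSpace K] (f : K → ℂ) (R : ℝ) (n : ℕ) (b : ℕ → K → ℂ)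
    (t : K) (β : Ordinal.{0}) (J : Finset ℕ) : OscPhase → Prop
  | .idle => ((R - jumpSum b J t : ℝ) : EReal) < posOsc (fun u => (f u).re) β t
  | .armed δ => 0 < n ∧ lastDist f b n t < δ ∧
      ∃ᶠ y in 𝓝 t, δ < (f y).re - (f t).re ∧ ∃ γ < β, ((R - jumpSum b J t + δ : ℝ) : EReal) <
        (((f y).re - (f t).re : ℝ) : EReal) + posOsc (fun u => (f u).re) γ y
  | .done => R < jumpSum b J t

/-- The invariant of a run before step `n`. -/
structure RunInv {K : Type*} [TopologicalSpace K] (f : K → ℂ) (R B : ℝ) (n : ℕ) (b : ℕ → K → ℂ)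
    (s : OscState K) : Prop where
  seen_lt : ∀ i ∈ s.seen, i < n
  jumps_lt : ∀ i ∈ s.jumps, i < n
  rest : restSum b s.seen n s.pt + lastDist f b n s.pt < B
  pos : ∀ i ∈ s.jumps, 0 < (diffSeq b i s.pt).re
  phase : PhaseInv f R n b s.pt s.ord s.jumps s.phase

/-- The effect on the phase of selecting the index `n`. -/
def PhaseStep {K : Type*} (n : ℕ) (s s' : OscState K) : OscPhase → Prop
  | .idle => s'.jumps = s.jumps ∧
      (s'.phase = .done ∨ (∃ δ, s'.phase = .armed δ) ∧ s'.ord = s.ord)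
  | .armed _ => s'.jumps = insert n s.jumps ∧ s'.phase = .idle ∧ s'.ord < s.ord
  | .done => s'.jumps = s.jumps ∧ s'.phase = .done ∧ s'.pt = s.pt

/-- The transitions of a run at step `n`; the bit tells whether the index `n` is selected. -/
def RunStep {K : Type*} (n : ℕ) : Bool → OscState K → OscState K → Prop
  | false, s, s' => s' = s
  | true, s, s' => s'.seen = insert n s.seen ∧ PhaseStep n s s' s.phase

/-! ### Dependence on finitely many terms, and basic estimates -/

section congr

variable {K : Type*} {b b' : ℕ → K → ℂ} {n : ℕ}

theorem jumpSum_congr (h : ∀ i < n, b i = b' i) {J : Finset ℕ} (hJ : ∀ i ∈ J, i < n) :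
    jumpSum b J = jumpSum b' J := by
  funext t
  exact Finset.sum_congr rfl fun i hi => by rw [diffSeq_congr h i (hJ i hi)]

theorem restSum_congr (h : ∀ i < n, b i = b' i) (E : Finset ℕ) :
    restSum b E n = restSum b' E n := by
  funext t
  refine Finset.sum_congr rfl fun i hi => ?_
  rw [diffSeq_congr h i (Finset.mem_Ico.1 (Finset.mem_sdiff.1 hi).1).2]

theorem lastDist_congr (f : K → ℂ) (h : ∀ i < n, b i = b' i) : lastDist f b n = lastDist f b' n := by
  cases n with
  | zero => rfl
  | succ n => funext t; simp [lastDist, h n n.lt_succ_self]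

theorem RunInv.congr [TopologicalSpace K] {f : K → ℂ} {R B : ℝ} {s : OscState K}
    (hs : RunInv f R B n b s) (h : ∀ i < n, b i = b' i) : RunInv f R B n b' s := by
  obtain ⟨h1, h2, h3, h4, h5⟩ := hs
  refine ⟨h1, h2, ?_, ?_, ?_⟩
  · rwa [← restSum_congr h, ← lastDist_congr f h]
  · intro i hi
    rw [← diffSeq_congr h i (h2 i hi)]
    exact h4 i hi
  · cases hp : s.phase <;> rw [hp] at h5 <;>
      simpa only [PhaseInv, ← jumpSum_congr h h2, ← lastDist_congr f h] using h5

end congr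

theorem restSum_succ_insert {K : Type*} (b : ℕ → K → ℂ) (E : Finset ℕ) (n : ℕ) (t : K) :
    restSum b (insert n E) (n + 1) t = restSum b E n t := by
  unfold restSum
  congr 1
  ext i
  simp only [Finset.mem_sdiff, Finset.mem_Ico, Finset.mem_insert]
  constructor
  · rintro ⟨h1, h2⟩
    exact ⟨by omega, by tauto⟩
  · rintro ⟨h1, h2⟩
    exact ⟨by omega, by rintro (h | h); exacts [by omega, h2 h]⟩

/-- Triangle inequality through `f t`. This is why the invariant budgets `restSum + lastDist`
together: the old distance is already paid for. -/
theorem restSum_succ_le {K : Type*} (f : K → ℂ) (b : ℕ → K → ℂ) (E : Finset ℕ) (n : ℕ) (t : K) :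
    restSum b E (n + 1) t ≤ restSum b E n t + lastDist f b n t + lastDist f b (n + 1) t := by
  unfold restSum
  cases n with
  | zero => simp [lastDist]
  | succ n =>
    have h1 : Finset.Ico 1 (n + 1 + 1) \ E ⊆ insert (n + 1) (Finset.Ico 1 (n + 1) \ E) := by
      intro i
      simp only [Finset.mem_sdiff, Finset.mem_Ico, Finset.mem_insert]
      rintro ⟨h1, h2⟩
      by_cases h : i = n + 1
      · exact Or.inl h
      · exact Or.inr ⟨by omega, h2⟩
    have h2 := Finset.sum_le_sum_of_subset_of_nonneg (f := fun i => ‖diffSeq b i t‖) h1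
      fun i _ _ => norm_nonneg _
    rw [Finset.sum_insert (by simp)] at h2
    have h3 : ‖diffSeq b (n + 1) t‖ ≤ ‖b (n + 1) t - f t‖ + ‖b n t - f t‖ := by
      have : diffSeq b (n + 1) t = (b (n + 1) t - f t) - (b n t - f t) := by simp [diffSeq]
      rw [this]
      exact norm_sub_le _ _
    simp only [lastDist]
    linarith

theorem lastDist_nonneg {K : Type*} (f : K → ℂ) (b : ℕ → K → ℂ) (n : ℕ) (t : K) :
    0 ≤ lastDist f b n t := by
  cases n with
  | zero => exact le_rfl
  | succ n => exact norm_nonneg _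

theorem continuous_jumpSum {K : Type*} [TopologicalSpace K] {b : ℕ → K → ℂ}
    (hb : ∀ n, Continuous (b n)) (J : Finset ℕ) : Continuous (jumpSum b J) :=
  continuous_finsetSum _ fun i _ => Complex.continuous_re.comp (continuous_diffSeq hb i)

theorem continuous_restSum {K : Type*} [TopologicalSpace K] {b : ℕ → K → ℂ}
    (hb : ∀ n, Continuous (b n)) (E : Finset ℕ) (n : ℕ) : Continuous (restSum b E n) :=
  continuous_finsetSum _ fun i _ => (continuous_diffSeq hb i).norm

theorem update_apply_of_lt {K : Type*} (F : ℕ → K → ℂ) (p : ℕ → ℕ) (n N : ℕ) :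
    ∀ i < n, F (p i) = F (Function.update p n N i) := fun i hi => by
  rw [Function.update_of_ne hi.ne]

theorem tendsto_lastDist_update {K : Type*} {f : K → ℂ} {F : ℕ → K → ℂ}
    (hF_lim : ∀ t, Tendsto (fun n => F n t) atTop (𝓝 (f t)))
    (p : ℕ → ℕ) (n : ℕ) (t : K) :
    Tendsto (fun N => lastDist f (fun i => F (Function.update p n N i)) (n + 1) t) atTop (𝓝 0) := by
  simp only [lastDist, Function.update_self]
  exact tendsto_iff_norm_sub_tendsto_zero.1 (hF_lim t)

theorem pos_update {K : Type*} {F : ℕ → K → ℂ} {n : ℕ} {p : ℕ → ℕ}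
    {J : Finset ℕ} (hJ : ∀ i ∈ J, i < n) {t : K}
    (h : ∀ i ∈ J, 0 < (diffSeq (fun i => F (p i)) i t).re) (N : ℕ) :
    ∀ i ∈ J, 0 < (diffSeq (fun i => F (Function.update p n N i)) i t).re := fun i hi => by
  rw [← diffSeq_congr (update_apply_of_lt F p n N) i (hJ i hi)]
  exact h i hi

/-! ### Preservation of the invariant in one step -/

section step

variable {K : Type*} [TopologicalSpace K] {f : K → ℂ} {F : ℕ → K → ℂ} {R B : ℝ} {n : ℕ}
  {p : ℕ → ℕ} {s : OscState K}

theorem RunInv.eventually_wait (hF_lim : ∀ t, Tendsto (fun n => F n t) atTop (𝓝 (f t)))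
    (hs : RunInv f R B n (fun i => F (p i)) s) :
    ∀ᶠ N in atTop, RunInv f R B (n + 1) (fun i => F (Function.update p n N i)) s := by
  obtain ⟨h1, h2, h3, h4, h5⟩ := hs
  have hl := tendsto_lastDist_update hF_lim p n s.pt
  -- Half the slack, since the new distance is counted twice: in the new difference and as the new
  -- `lastDist`.
  have hB := hl.eventually_lt_const
    (show 0 < (B - (restSum (fun i => F (p i)) s.seen n s.pt +
      lastDist f (fun i => F (p i)) n s.pt)) / 2 by linarith)
  have hphase : ∀ᶠ N in atTop, PhaseInv f R (n + 1) (fun i => F (Function.update p n N i))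
      s.pt s.ord s.jumps s.phase := by
    cases hp : s.phase with
    | idle =>
      rw [hp] at h5
      refine Eventually.of_forall fun N => ?_
      simpa only [PhaseInv, ← jumpSum_congr (update_apply_of_lt F p n N) h2] using h5
    | done =>
      rw [hp] at h5
      refine Eventually.of_forall fun N => ?_
      simpa only [PhaseInv, ← jumpSum_congr (update_apply_of_lt F p n N) h2] using h5
    | armed δ =>
      rw [hp] at h5
      obtain ⟨-, h5, h6⟩ := h5
      filter_upwards [hl.eventually_lt_const ((lastDist_nonneg _ _ _ _).trans_lt h5)] with N hN
      refine ⟨n.succ_pos, hN, ?_⟩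
      rwa [← jumpSum_congr (update_apply_of_lt F p n N) h2]
  filter_upwards [hB, hphase] with N hN hN'
  refine ⟨fun i hi => (h1 i hi).trans n.lt_succ_self, fun i hi => (h2 i hi).trans n.lt_succ_self,
    ?_, ?_, hN'⟩
  · have h6 := restSum_succ_le f (fun i => F (Function.update p n N i)) s.seen n s.pt
    rw [← restSum_congr (update_apply_of_lt F p n N),
      ← lastDist_congr f (update_apply_of_lt F p n N)] at h6
    linarith
  · intro i hi
    rw [← diffSeq_congr (update_apply_of_lt F p n N) i (h2 i hi)]
    exact h4 i hi

/-- The part of the invariant that does not depend on the phase survives a step to a nearby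
point at which the index `n` is selected. -/
theorem eventually_runInv_of_phase (hF_lim : ∀ t, Tendsto (fun n => F n t) atTop (𝓝 (f t)))
    {s' : OscState K} {E : Finset ℕ} (hE : ∀ i ∈ E, i < n) (hseen : s'.seen = insert n E)
    (hjumps : ∀ i ∈ s'.jumps, i < n + 1)
    (hrest : restSum (fun i => F (p i)) E n s'.pt < B)
    (hpos : ∀ᶠ N in atTop, ∀ i ∈ s'.jumps,
      0 < (diffSeq (fun i => F (Function.update p n N i)) i s'.pt).re)
    (hphase : ∀ᶠ N in atTop, PhaseInv f R (n + 1) (fun i => F (Function.update p n N i))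
      s'.pt s'.ord s'.jumps s'.phase) :
    ∀ᶠ N in atTop, RunInv f R B (n + 1) (fun i => F (Function.update p n N i)) s' := by
  filter_upwards [(tendsto_lastDist_update hF_lim p n s'.pt).eventually_lt_const
    (sub_pos.2 hrest), hpos, hphase] with N hN hN1 hN2
  refine ⟨?_, hjumps, ?_, hN1, hN2⟩
  · intro i hi
    rw [hseen, Finset.mem_insert] at hi
    rcases hi with rfl | hi
    · exact i.lt_succ_self
    · exact (hE i hi).trans n.lt_succ_self
  · rw [hseen, restSum_succ_insert, ← restSum_congr (update_apply_of_lt F p n N)]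
    linarith

theorem RunInv.restSum_lt (hs : RunInv f R B n (fun i => F (p i)) s) :
    restSum (fun i => F (p i)) s.seen n s.pt < B :=
  (le_add_of_nonneg_right (lastDist_nonneg _ _ _ _)).trans_lt hs.rest

theorem RunInv.eventually_nhds (hF_cont : ∀ n, Continuous (F n))
    (hs : RunInv f R B n (fun i => F (p i)) s) :
    ∀ᶠ z in 𝓝 s.pt, restSum (fun i => F (p i)) s.seen n z < B ∧
      ∀ i ∈ s.jumps, 0 < (diffSeq (fun i => F (p i)) i z).re := by
  have hb : ∀ i, Continuous (F (p i)) := fun i => hF_cont _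
  refine ((continuous_restSum hb s.seen n).continuousAt.eventually_lt_const hs.restSum_lt).and ?_
  exact (Filter.eventually_all_finset _).2 fun i hi =>
    (Complex.continuous_re.comp (continuous_diffSeq hb i)).continuousAt.eventually_const_lt
      (hs.pos i hi)

theorem RunInv.eventually_select_done (hF_lim : ∀ t, Tendsto (fun n => F n t) atTop (𝓝 (f t)))
    (hs : RunInv f R B n (fun i => F (p i)) s) (h : R < jumpSum (fun i => F (p i)) s.jumps s.pt) :
    ∀ᶠ N in atTop, RunInv f R B (n + 1) (fun i => F (Function.update p n N i))
      { s with seen := insert n s.seen, phase := .done } := by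
  refine eventually_runInv_of_phase hF_lim hs.seen_lt rfl
    (fun i hi => (hs.jumps_lt i hi).trans n.lt_succ_self) hs.restSum_lt
    (Eventually.of_forall (pos_update hs.jumps_lt hs.pos))
    (Eventually.of_forall fun N => ?_)
  simpa only [PhaseInv, ← jumpSum_congr (update_apply_of_lt F p n N) hs.jumps_lt] using h

theorem RunInv.exists_select_idle (hF_cont : ∀ n, Continuous (F n))
    (hF_lim : ∀ t, Tendsto (fun n => F n t) atTop (𝓝 (f t)))
    (hs : RunInv f R B n (fun i => F (p i)) s) (hp : s.phase = .idle)
    (h : jumpSum (fun i => F (p i)) s.jumps s.pt ≤ R) :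
    ∃ z δ, ∀ᶠ N in atTop, RunInv f R B (n + 1) (fun i => F (Function.update p n N i))
      ⟨z, s.ord, insert n s.seen, s.jumps, .armed δ⟩ := by
  have hb : ∀ i, Continuous (F (p i)) := fun i => hF_cont _
  have hph := hs.phase
  rw [hp] at hph
  obtain ⟨c, hc1, hc2⟩ := EReal.lt_iff_exists_real_btwn.1 hph
  have hc1 := EReal.coe_lt_coe_iff.1 hc1
  have hz := (continuous_jumpSum hb s.jumps).continuousAt.eventually_const_lt
    (show R - c < jumpSum (fun i => F (p i)) s.jumps s.pt by linarith)
  obtain ⟨z, ⟨δ, hδ, hfreq⟩, ⟨hz1, hz2⟩, hz3⟩ :=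
    ((frequently_jump_of_lt_posOsc _ _ _ c (by linarith) hc2).and_eventually
      ((hs.eventually_nhds hF_cont).and hz)).exists
  -- The second entry gives `R - jumpSum z + δ' ≤ c`, so an error of `δ'` in the coming jump is
  -- affordable.
  set δ' := min δ (jumpSum (fun i => F (p i)) s.jumps z + c - R) with hδ'
  have hδ'0 : 0 < δ' := lt_min hδ (by linarith)
  refine ⟨z, δ', eventually_runInv_of_phase hF_lim hs.seen_lt rfl
    (fun i hi => (hs.jumps_lt i hi).trans n.lt_succ_self) hz1
    (Eventually.of_forall (pos_update hs.jumps_lt hz2)) ?_⟩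
  filter_upwards [(tendsto_lastDist_update hF_lim p n z).eventually_lt_const hδ'0] with N hN
  refine ⟨n.succ_pos, hN, hfreq.mono ?_⟩
  rintro y ⟨hy, γ, hγ, hy'⟩
  refine ⟨(min_le_left _ _).trans_lt hy, γ, hγ, lt_of_le_of_lt (EReal.coe_le_coe_iff.2 ?_) hy'⟩
  rw [← jumpSum_congr (update_apply_of_lt F p n N) hs.jumps_lt]
  have := min_le_right δ (jumpSum (fun i => F (p i)) s.jumps z + c - R)
  linarith

/-- The last chosen term is within `δ` of `f` at the current point, and by continuity its real part
stays below `(f s.pt).re + δ` nearby. As the jump of `Re f` exceeds `δ`, the new difference is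
positive; the loss of at most `δ` was reserved in the armed phase. -/
theorem RunInv.exists_select_armed (hF_cont : ∀ n, Continuous (F n))
    (hF_lim : ∀ t, Tendsto (fun n => F n t) atTop (𝓝 (f t)))
    (hs : RunInv f R B n (fun i => F (p i)) s) {δ : ℝ} (hp : s.phase = .armed δ) :
    ∃ y, ∃ γ < s.ord, ∀ᶠ N in atTop, RunInv f R B (n + 1) (fun i => F (Function.update p n N i))
      ⟨y, γ, insert n s.seen, insert n s.jumps, .idle⟩ := by
  have hb : ∀ i, Continuous (F (p i)) := fun i => hF_cont _
  have hph := hs.phase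
  rw [hp] at hph
  obtain ⟨hn, hlast, hfreq⟩ := hph
  -- From here on `F (p n)` is the last term chosen, and `n + 1` is the index being selected.
  obtain ⟨n, rfl⟩ : ∃ k, n = k + 1 := ⟨n - 1, by omega⟩
  have hre : |(F (p n) s.pt).re - (f s.pt).re| < δ := by
    rw [← Complex.sub_re]
    exact (Complex.abs_re_le_norm _).trans_lt hlast
  rw [abs_lt] at hre
  have hcr : Continuous fun u => (F (p n) u).re := Complex.continuous_re.comp (hb n)
  have hy1 := hcr.continuousAt.eventually_lt_const
    (show (F (p n) s.pt).re < (f s.pt).re + δ by linarith)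
  have hy2 := ((continuous_jumpSum hb s.jumps).sub hcr).continuousAt.eventually_const_lt
    (show jumpSum (fun i => F (p i)) s.jumps s.pt - (f s.pt).re - δ <
      jumpSum (fun i => F (p i)) s.jumps s.pt - (F (p n) s.pt).re by linarith)
  obtain ⟨y, ⟨hy, γ, hγ, hv⟩, ⟨hz1, hz2⟩, hz3, hz4⟩ :=
    (hfreq.and_eventually ((hs.eventually_nhds hF_cont).and (hy1.and hy2))).exists
  have hdiff : ∀ N, (diffSeq (fun i => F (Function.update p (n + 1) N i)) (n + 1) y).re =
      (F N y).re - (F (p n) y).re := by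
    intro N
    simp [diffSeq]
  have hlim : Tendsto (fun N => (F N y).re) atTop (𝓝 (f y).re) :=
    (Complex.continuous_re.tendsto _).comp (hF_lim y)
  refine ⟨y, γ, hγ, eventually_runInv_of_phase hF_lim hs.seen_lt rfl ?_ hz1 ?_ ?_⟩
  · intro i hi
    rcases Finset.mem_insert.1 hi with rfl | hi
    · exact Nat.lt_succ_self _
    · exact (hs.jumps_lt i hi).trans (Nat.lt_succ_self _)
  · filter_upwards [hlim.eventually_const_lt (show (F (p n) y).re < (f y).re by linarith)] with N hN
    intro i hi
    rcases Finset.mem_insert.1 hi with rfl | hi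
    · rw [hdiff]
      exact sub_pos.2 hN
    · exact pos_update hs.jumps_lt hz2 N i hi
  · rw [Pi.sub_apply] at hz4
    have hlt : R - jumpSum (fun i => F (p i)) s.jumps y + (F (p n) y).re - (f y).re <
      R - jumpSum (fun i => F (p i)) s.jumps s.pt + δ - ((f y).re - (f s.pt).re) := by linarith
    filter_upwards [hlim.eventually_const_lt (show (F (p n) y).re + R -
      jumpSum (fun i => F (p i)) s.jumps y - (R - jumpSum (fun i => F (p i)) s.jumps s.pt + δ -
        ((f y).re - (f s.pt).re)) < (f y).re by linarith)] with N hN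
    have hsum : jumpSum (fun i => F (Function.update p (n + 1) N i)) (insert (n + 1) s.jumps) y =
        (F N y).re - (F (p n) y).re + jumpSum (fun i => F (p i)) s.jumps y := by
      rw [jumpSum_congr (update_apply_of_lt F p (n + 1) N) hs.jumps_lt, jumpSum, Finset.sum_insert,
        hdiff, jumpSum]
      exact fun h => (hs.jumps_lt _ h).false
    show ((R - jumpSum _ (insert (n + 1) s.jumps) y : ℝ) : EReal) < _
    rw [hsum]
    -- The oscillation at `y` may be infinite, so a real bound on it is assumed and contradicted
    -- instead of subtracting in `EReal`.
    by_contra hcon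
    refine absurd hv (not_lt.2 ((add_le_add_right (not_lt.1 hcon) _).trans ?_))
    rw [← EReal.coe_add, EReal.coe_le_coe_iff]
    linarith

theorem RunInv.exists_step (hF_cont : ∀ n, Continuous (F n))
    (hF_lim : ∀ t, Tendsto (fun n => F n t) atTop (𝓝 (f t)))
    (hs : RunInv f R B n (fun i => F (p i)) s) (c : Bool) :
    ∃ s', RunStep n c s s' ∧
      ∀ᶠ N in atTop, RunInv f R B (n + 1) (fun i => F (Function.update p n N i)) s' := by
  cases c with
  | false => exact ⟨s, rfl, hs.eventually_wait hF_lim⟩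
  | true =>
    cases hp : s.phase with
    | done =>
      have h := hs.phase
      rw [hp] at h
      exact ⟨_, ⟨rfl, by rw [hp]; exact ⟨rfl, rfl, rfl⟩⟩, hs.eventually_select_done hF_lim h⟩
    | idle =>
      rcases lt_or_ge R (jumpSum (fun i => F (p i)) s.jumps s.pt) with h | h
      · exact ⟨_, ⟨rfl, by rw [hp]; exact ⟨rfl, Or.inl rfl⟩⟩, hs.eventually_select_done hF_lim h⟩
      · obtain ⟨z, δ, hz⟩ := hs.exists_select_idle hF_cont hF_lim hp h
        exact ⟨_, ⟨rfl, by rw [hp]; exact ⟨rfl, Or.inr ⟨⟨δ, rfl⟩, rfl⟩⟩⟩, hz⟩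
    | armed δ =>
      obtain ⟨y, γ, hγ, hy⟩ := hs.exists_select_armed hF_cont hF_lim hp
      exact ⟨_, ⟨rfl, by rw [hp]; exact ⟨rfl, rfl, hγ⟩⟩, hy⟩

end step

/-! ### Termination and bookkeeping along a fixed index sequence -/

section run

variable {K : Type*} {m : ℕ → ℕ} {c : ℕ → Bool} {s : ℕ → OscState K}

theorem seen_run (hc : ∀ n, c n = true ↔ n ∈ Set.range m) (h₀ : (s 0).seen = ∅)
    (hs : ∀ n, RunStep n (c n) (s n) (s (n + 1))) (n i : ℕ) :
    i ∈ (s n).seen ↔ i < n ∧ i ∈ Set.range m := by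
  induction n with
  | zero => simp [h₀]
  | succ n ih =>
    have hn := hs n
    have hcn := hc n
    cases hb : c n with
    | false =>
      rw [hb] at hn hcn
      rw [show s (n + 1) = s n from hn, ih]
      constructor
      · rintro ⟨h1, h2⟩
        exact ⟨by omega, h2⟩
      · rintro ⟨h1, h2⟩
        refine ⟨lt_of_le_of_ne (by omega) ?_, h2⟩
        rintro rfl
        exact absurd (hcn.2 h2) (by simp)
    | true =>
      rw [hb] at hn hcn
      rw [hn.1, Finset.mem_insert, ih]
      constructor
      · rintro (rfl | ⟨h1, h2⟩)
        · exact ⟨by omega, hcn.1 rfl⟩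
        · exact ⟨by omega, h2⟩
      · rintro ⟨h1, h2⟩
        by_cases h : i = n
        · exact Or.inl h
        · exact Or.inr ⟨by omega, h2⟩

theorem run_eq_of_lt (hm : StrictMono m) (hc : ∀ n, c n = true ↔ n ∈ Set.range m)
    (hs : ∀ n, RunStep n (c n) (s n) (s (n + 1))) (j : ℕ) :
    s (m (j + 1)) = s (m j + 1) := by
  have key : ∀ n, m j + 1 ≤ n → n ≤ m (j + 1) → s n = s (m j + 1) := by
    intro n hn
    induction n, hn using Nat.le_induction with
    | base => exact fun _ => rfl
    | succ n hn ih =>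
      intro h
      rw [← ih (by omega)]
      have hb : c n = false := by
        rw [Bool.eq_false_iff]
        intro h'
        obtain ⟨i, rfl⟩ := (hc n).1 h'
        have h1 := hm.lt_iff_lt.1 (show m j < m i by omega)
        have h2 := hm.lt_iff_lt.1 (show m i < m (j + 1) by omega)
        omega
      have := hs n
      rw [hb] at this
      exact this
  exact key _ (hm (Nat.lt_succ_self j)) le_rfl

/-- A run ends, because the order of oscillation that is left decreases with each jump. -/
theorem exists_done_of_idle (hm : StrictMono m) (hc : ∀ n, c n = true ↔ n ∈ Set.range m)
    (hs : ∀ n, RunStep n (c n) (s n) (s (n + 1))) (β : Ordinal.{0}) :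
    ∀ j, (s (m (2 * j))).ord = β → (s (m (2 * j))).phase = .idle →
      (s (m (2 * j))).jumps = (Finset.range j).image (fun i => m (2 * i + 1)) →
      ∃ n k, (s n).phase = .done ∧
        (s n).jumps = (Finset.range k).image (fun i => m (2 * i + 1)) := by
  induction β using WellFoundedLT.induction with
  | ind β ih =>
    intro j hβ hp hJ
    have h1 := hs (m (2 * j))
    rw [(hc _).2 ⟨_, rfl⟩] at h1
    have h1 := h1.2
    rw [hp] at h1
    obtain ⟨h1, h2 | ⟨⟨δ, h2⟩, h3⟩⟩ := h1
    · exact ⟨_, j, h2, h1.trans hJ⟩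
    · have h4 := hs (m (2 * j + 1))
      rw [(hc _).2 ⟨_, rfl⟩] at h4
      have h4 := h4.2
      rw [run_eq_of_lt hm hc hs, h2] at h4
      obtain ⟨h4, h5, h6⟩ := h4
      have h7 : s (m (2 * (j + 1))) = s (m (2 * j + 1) + 1) := run_eq_of_lt hm hc hs (2 * j + 1)
      refine ih _ ?_ (j + 1) rfl (by rw [h7, h5]) ?_
      · rw [h7, ← hβ, ← h3]
        exact h6
      · rw [h7, h4, h1, hJ, Finset.range_add_one, Finset.image_insert]

theorem run_done (hs : ∀ n, RunStep n (c n) (s n) (s (n + 1))) {n₀ : ℕ}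
    (h : (s n₀).phase = .done) : ∀ n ≥ n₀, (s n).phase = .done ∧ (s n).pt = (s n₀).pt := by
  intro n hn
  induction n, hn using Nat.le_induction with
  | base => exact ⟨h, rfl⟩
  | succ n hn ih =>
    have h1 := hs n
    cases hb : c n with
    | false =>
      rw [hb] at h1
      rw [show s (n + 1) = s n from h1]
      exact ih
    | true =>
      rw [hb] at h1
      have h1 := h1.2
      rw [ih.1] at h1
      exact ⟨h1.2.1, h1.2.2.trans ih.2⟩

end run

/-! ### Conclusion -/

theorem summable_and_tsum_le_of_restSum_lt {K : Type*} (b : ℕ → K → ℂ) (M : Set ℕ) (h0 : 0 ∈ M)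
    (t : K) (E : ℕ → Finset ℕ) (hE : ∀ n i, i ∈ E n ↔ i < n ∧ i ∈ M) (B : ℝ) (n₀ : ℕ)
    (h : ∀ n ≥ n₀, restSum b (E n) n t ≤ B) :
    Summable (fun i : {i : ℕ // i ∉ M} => ‖diffSeq b i.1 t‖) ∧
      ∑' i : {i : ℕ // i ∉ M}, ‖diffSeq b i.1 t‖ ≤ B := by
  set g : ℕ → ℝ := Set.indicator Mᶜ fun i => ‖diffSeq b i t‖ with hg
  have hg0 : ∀ i, 0 ≤ g i := fun i => Set.indicator_nonneg (fun _ _ => norm_nonneg _) i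
  have hsum : ∀ n, ∑ i ∈ Finset.range n, g i = restSum b (E n) n t := by
    intro n
    rw [restSum]
    symm
    refine Finset.sum_subset_zero_on_sdiff ?_ ?_ ?_
    · intro i hi
      rw [Finset.mem_sdiff, Finset.mem_Ico] at hi
      exact Finset.mem_range.2 hi.1.2
    · intro i hi
      rw [Finset.mem_sdiff, Finset.mem_sdiff, Finset.mem_Ico, Finset.mem_range, hE] at hi
      refine Set.indicator_of_notMem (not_not.2 ?_ : ¬ i ∈ Mᶜ) _
      -- `restSum` omits index `0`; nothing is lost because `0` is in `M`.
      by_cases hi0 : i = 0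
      · rwa [hi0]
      · by_contra hM
        exact hi.2 ⟨⟨by omega, hi.1⟩, fun h => hM h.2⟩
    · intro i hi
      rw [Finset.mem_sdiff, Finset.mem_Ico, hE] at hi
      have hM : i ∈ Mᶜ := fun h => hi.2 ⟨hi.1.2, h⟩
      rw [hg, Set.indicator_of_mem hM]
  have hle : ∀ n, ∑ i ∈ Finset.range n, g i ≤ B := by
    intro n
    -- The bound is known only from `n₀` on; earlier partial sums are smaller because the terms are
    -- nonnegative.
    refine (Finset.sum_le_sum_of_subset_of_nonneg
      (Finset.range_mono (le_max_left n n₀)) fun i _ _ => hg0 i).trans ?_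
    rw [hsum]
    exact h _ (le_max_right _ _)
  refine ⟨?_, ?_⟩
  · exact summable_subtype_iff_indicator.2 (summable_of_sum_range_le hg0 hle)
  · refine le_of_eq_of_le ?_ (Real.tsum_le_of_sum_range_le hg0 hle)
    exact tsum_subtype Mᶜ fun i => ‖diffSeq b i t‖

/-- All sequences are indexed from `0`; in one-based notation, `m i` is `m_{i+1} - 1`, so that
`m 0 = 0` says `m_1 = 1` and, for `j < k`, `diffSeq b (m (2 * j + 1))` is `e_{m_{2(j+1)}}`. -/
theorem theorem4p1 {K : Type*} [MetricSpace K] [TopologicalSpace.SeparableSpace K]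
    (α : Ordinal.{0}) (hα : 1 ≤ α) (hα_countable : α.card ≤ Cardinal.aleph0)
    (f : K → ℂ) (F : ℕ → K → ℂ)
    (hF_cont : ∀ n, Continuous (F n))
    (hF_bdd : ∃ C : ℝ, ∀ n t, ‖F n t‖ ≤ C)
    (hF_lim : ∀ t, Tendsto (fun n => F n t) atTop (𝓝 (f t)))
    (x : K) (lam : ℝ) (hlam_pos : 0 < lam)
    (hlam : posOsc (fun t => (f t).re) α x = (lam : EReal))
    (η : ℝ) (hη_pos : 0 < η) (hη_lt : η < 1) :
    ∃ σ : ℕ → ℕ, StrictMono σ ∧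
      ∀ m : ℕ → ℕ, StrictMono m → m 0 = 0 →
        ∃ (t : K) (k : ℕ),
          (1 - η) * lam <
              ∑ j ∈ Finset.range k, (diffSeq (fun i => F (σ i)) (m (2 * j + 1)) t).re ∧
          (∀ j < k, 0 < (diffSeq (fun i => F (σ i)) (m (2 * j + 1)) t).re) ∧
          Summable (fun i : {i : ℕ // i ∉ Set.range m} =>
            ‖diffSeq (fun i => F (σ i)) i.1 t‖) ∧
          ∑' i : {i : ℕ // i ∉ Set.range m}, ‖diffSeq (fun i => F (σ i)) i.1 t‖ < η * lam := by
  obtain ⟨σ, hσ, hrun⟩ := exists_strictMono_forall_run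
    -- The budget is half of `η * lam` because the infinite sum inherits only a non-strict bound.
    (fun n p s => RunInv f ((1 - η) * lam) (η * lam / 2) n (fun i => F (p i)) s) RunStep
    (⟨x, α, ∅, ∅, .idle⟩ : OscState K)
    (fun n p q s h hs => hs.congr fun i hi => by rw [h i hi])
    (fun n p s c hs => hs.exists_step hF_cont hF_lim c)
    ⟨by simp, by simp, by simp [restSum, lastDist]; positivity, by simp, by
      simp only [PhaseInv, jumpSum, Finset.sum_empty, hlam, EReal.coe_lt_coe_iff]
      nlinarith [mul_pos hη_pos hlam_pos]⟩
  refine ⟨σ, hσ, fun m hm hm0 => ?_⟩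
  classical
  obtain ⟨s, hs0, hs⟩ := hrun fun n => decide (n ∈ Set.range m)
  have hc : ∀ n, decide (n ∈ Set.range m) = true ↔ n ∈ Set.range m := fun n => decide_eq_true_iff
  have hstep := fun n => (hs n).1
  obtain ⟨n₀, k, hdone, hJ⟩ := exists_done_of_idle hm hc hstep α 0
    (by simp [hm0, hs0]) (by simp [hm0, hs0]) (by simp [hm0, hs0])
  have hinv := (hs n₀).2
  have hph := hinv.phase
  rw [hdone] at hph
  have hinj : Set.InjOn (fun i => m (2 * i + 1)) (Finset.range k) := by
    intro i _ j _ hij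
    have := hm.injective hij
    omega
  obtain ⟨h1, h2⟩ := summable_and_tsum_le_of_restSum_lt (fun i => F (σ i)) (Set.range m) ⟨0, hm0⟩
    (s n₀).pt (fun n => (s n).seen) (seen_run hc (by rw [hs0]) hstep) (η * lam / 2) n₀
    (fun n hn => by
      rw [← (run_done hstep hdone n hn).2]
      exact (hs n).2.restSum_lt.le)
  refine ⟨(s n₀).pt, k, ?_, ?_, h1, h2.trans_lt (half_lt_self (by positivity))⟩
  · simp only [PhaseInv, jumpSum, hJ] at hph
    rwa [Finset.sum_image hinj] at hph
  · intro j hj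
    refine hinv.pos _ ?_
    rw [hJ]
    exact Finset.mem_image.2 ⟨j, Finset.mem_range.2 hj, rfl⟩
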